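/- Let $G$ be a finite simple graph and let $V_0\subseteq V(G)$ be a non-empty clique, i.e. a set of $k\ge 1$ pairwise adjacent vertices. Let $F=G-E(G[V_0])$ be the spanning subgraph of $G$ obtained by deleting all edges with both ends in $V_0$. Assume that $F$ is a forest and that each vertex of $V_0$ is incident with at most one edge of $F$. For disjoint sets $A,B$ of vertices let $E_G(A,B)$ be the set of edges of $G$ with one end in $A$ and the other in $B$, and let $E_G(A)=E_G(A,V(G)\setminus A)$. Let $d=|E_G(V_0)|$ and let $F_1,\dots,F_t$ ($t\ge 0$) be the connected components of $G-V_0$, the subgraph of $G$ induced by $V(G)\setminus V_0$. Then the number of spanning trees of $G$ that contain all edges of $F$ equals $$k^{\,k-2+t-d}\prod_{j=1}^{t}|E_G(V_0,V(F_j))|,$$ where the exponent is an integer that may be negative, and the empty product is $1$. ($G$ is not assumed to be connected; if it is disconnected, both sides are $0$.) -/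

import Mathlib

namespace CliqueForest

variable {V : Type*}

/-- The spanning subgraph `G - E(G[V₀])`: delete from `G` all edges with both ends in `V₀`. -/
def minusInducedEdges (G : SimpleGraph V) (V₀ : Set V) : SimpleGraph V :=
  G.deleteEdges (G.induce V₀).spanningCoe.edgeSet

/-- `E_G(A, B)`: the edges of `G` with one end in `A` and the other end in `B`
(used for disjoint `A` and `B`). -/
def edgesBetween (G : SimpleGraph V) (A B : Set V) : Set (Sym2 V) :=
  {e | e ∈ G.edgeSet ∧ ∃ a ∈ A, ∃ b ∈ B, e = s(a, b)}

/-- `E_G(A) = E_G(A, V(G) - A)`. -/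
def edgeCut (G : SimpleGraph V) (A : Set V) : Set (Sym2 V) :=
  edgesBetween G A Aᶜ

/-- The components of `G - V₀`, where `G - V₀` is the subgraph induced by the complement
of `V₀`. -/
abbrev OuterComponent (G : SimpleGraph V) (V₀ : Set V) : Type _ :=
  (G.induce V₀ᶜ).ConnectedComponent

/-- The vertex set of a component of `G - V₀`, as a set of vertices of `G`. -/
def outerVerts (G : SimpleGraph V) (V₀ : Set V) (C : OuterComponent G V₀) : Set V :=
  Subtype.val '' C.supp

/-- The set of spanning trees of `G` that contain all edges of `F`. A spanning subgraph of `G`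
is a graph on the same vertex type that lies below `G`. -/
def spanningTreesContaining (G F : SimpleGraph V) : Set (SimpleGraph V) :=
  {T | T ≤ G ∧ T.IsTree ∧ F.edgeSet ⊆ T.edgeSet}

end CliqueForest

open SimpleGraph

namespace CliqueForest

/-! ### Effect of one added edge on components, edge counts and weights -/

section Merge

variable {V : Type*} {F : SimpleGraph V} {u v : V}

/-! This is a weighted form of Cayley's formula. As `V₀` is a clique, one counts the ways to
complete the forest `F` to a tree by edges inside `S = V₀`. For a forest with `c` components whose
intersections with `S` have sizes `w_i`, the number is `|S| ^ (c - 2) * ∏ w_i`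
(`ncard_treeExtensions`). The proof is by induction on `c`, counting pairs of a completion `T` and
an ordered pair `(u, v)` joined by an edge of `T` outside `F`. Each `T` has `2 (c - 1)` such pairs.
For fixed `(u, v)`, the possible `T` are the completions of `F + uv`, where weights `a`, `b` become
`a + b = a b (1/a + 1/b)`. Summing the reciprocals over all admissible pairs gives `2 (c - 1) |S|`,
which closes the induction. Finally, each vertex of `V₀` has at most one edge in `F`, so it is
either isolated or attached to exactly one component of `G - V₀`. Thus `c = k - d + t`, the isolated
vertices have weight `1`, and the component containing `F_j` has weight `|E_G(V₀, V(F_j))|`. -/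

theorem reachable_sup_edge_iff {x y : V} :
    (F ⊔ edge u v).Reachable x y ↔ F.Reachable x y ∨ (F.Reachable x u ∧ F.Reachable v y) ∨
      (F.Reachable x v ∧ F.Reachable u y) := by
  constructor
  · rintro ⟨p⟩
    induction p with
    | nil => exact .inl .rfl
    | @cons a b c h p ih =>
      have key : F.Reachable a b ∨ (a = u ∧ b = v) ∨ (a = v ∧ b = u) := by
        rcases h with h | h
        · exact .inl h.reachable
        · exact .inr ((edge_adj ..).1 h).1
      rcases key with h | ⟨rfl, rfl⟩ | ⟨rfl, rfl⟩
      · rcases ih with ih | ⟨h1, h2⟩ | ⟨h1, h2⟩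
        · exact .inl (h.trans ih)
        · exact .inr (.inl ⟨h.trans h1, h2⟩)
        · exact .inr (.inr ⟨h.trans h1, h2⟩)
      · rcases ih with ih | ⟨h1, h2⟩ | ⟨h1, h2⟩
        · exact .inr (.inl ⟨.rfl, ih⟩)
        · exact .inl (h1.symm.trans h2)
        · exact .inl h2
      · rcases ih with ih | ⟨h1, h2⟩ | ⟨h1, h2⟩
        · exact .inr (.inr ⟨.rfl, ih⟩)
        · exact .inl h2
        · exact .inl (h1.symm.trans h2)
  · have huv : (F ⊔ edge u v).Reachable u v := by
      by_cases h : u = v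
      · subst h; exact .rfl
      · exact Adj.reachable (Or.inr ((edge_adj ..).2 ⟨.inl ⟨rfl, rfl⟩, h⟩))
    have hm : ∀ {a b}, F.Reachable a b → (F ⊔ edge u v).Reachable a b :=
      fun h => h.mono le_sup_left
    rintro (h | ⟨h1, h2⟩ | ⟨h1, h2⟩)
    · exact hm h
    · exact (hm h1).trans (huv.trans (hm h2))
    · exact (hm h1).trans (huv.symm.trans (hm h2))

/-- Adding an edge between two components merges them: the new components correspond to the old
ones other than the component of `v`. -/
noncomputable def mergeEquiv (h : ¬ F.Reachable u v) :
    {C : F.ConnectedComponent // C ≠ F.connectedComponentMk v} ≃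
      (F ⊔ edge u v).ConnectedComponent :=
  Equiv.ofBijective (fun C => C.1.map (Hom.ofLE le_sup_left)) <| by
    constructor
    · rintro ⟨C, hC⟩ ⟨D, hD⟩ hCD
      induction C using ConnectedComponent.ind with | _ x
      induction D using ConnectedComponent.ind with | _ y
      have hx : ¬ F.Reachable x v := fun hx => hC (ConnectedComponent.sound hx)
      have hy : ¬ F.Reachable y v := fun hx => hD (ConnectedComponent.sound hx)
      rcases reachable_sup_edge_iff.1 (ConnectedComponent.exact hCD) with h | h | h
      · exact Subtype.ext (ConnectedComponent.sound h)
      · exact absurd h.2.symm hy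
      · exact absurd h.1 hx
    · intro D
      induction D using ConnectedComponent.ind with | _ y
      by_cases hy : F.Reachable y v
      -- The component of `v` is excluded from the domain, so the merged class is reached through
      -- `u`.
      · refine ⟨⟨F.connectedComponentMk u, fun hu => h (ConnectedComponent.exact hu)⟩, ?_⟩
        exact ConnectedComponent.sound (reachable_sup_edge_iff.2 (.inr (.inl ⟨.rfl, hy.symm⟩)))
      · exact ⟨⟨F.connectedComponentMk y, fun hu => hy (ConnectedComponent.exact hu)⟩, rfl⟩

theorem mergeEquiv_apply (h : ¬ F.Reachable u v)
    (C : {C : F.ConnectedComponent // C ≠ F.connectedComponentMk v}) :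
    mergeEquiv h C = C.1.map (Hom.ofLE le_sup_left) := rfl

theorem card_connectedComponent_sup_edge [Finite V] (h : ¬ F.Reachable u v) :
    Nat.card (F ⊔ edge u v).ConnectedComponent + 1 = Nat.card F.ConnectedComponent := by
  classical
  have := Fintype.ofFinite F.ConnectedComponent
  rw [← Nat.card_congr (mergeEquiv h), Nat.card_eq_fintype_card, Nat.card_eq_fintype_card,
    Fintype.card_subtype_compl, Fintype.card_subtype_eq]
  have : 0 < Fintype.card F.ConnectedComponent :=
    Fintype.card_pos_iff.2 ⟨F.connectedComponentMk v⟩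
  omega

theorem ncard_edgeSet_sup_edge [Finite V] (h : ¬ F.Reachable u v) :
    (F ⊔ edge u v).edgeSet.ncard = F.edgeSet.ncard + 1 := by
  have hne : u ≠ v := by rintro rfl; exact h .rfl
  rw [edgeSet_sup, edgeSet_edge_of_ne hne, Set.union_singleton,
    Set.ncard_insert_of_notMem (a := s(u, v)) (fun h' => h (Adj.reachable h')) (Set.toFinite _)]

/-- The number of vertices of `S` in a component. -/
noncomputable def weight (S : Set V) (C : F.ConnectedComponent) : ℕ := (C.supp ∩ S).ncard

theorem weight_map_of_ne [Finite V] (S : Set V) {C : F.ConnectedComponent}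
    (hu : C ≠ F.connectedComponentMk u) (hv : C ≠ F.connectedComponentMk v) :
    weight S (C.map (Hom.ofLE (le_sup_left : F ≤ F ⊔ edge u v))) = weight S C := by
  induction C using ConnectedComponent.ind with | _ x
  have hu : ¬ F.Reachable x u := fun hx => hu (ConnectedComponent.sound hx)
  have hv : ¬ F.Reachable x v := fun hx => hv (ConnectedComponent.sound hx)
  unfold weight
  congr 2
  ext y
  simp only [ConnectedComponent.map_mk, ConnectedComponent.mem_supp_iff, ConnectedComponent.eq,
    reachable_sup_edge_iff, Hom.ofLE_apply]
  constructor
  · rintro (h | h | h)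
    · exact h
    · exact absurd h.2.symm hv
    · exact absurd h.2.symm hu
  · exact .inl

theorem weight_map_merge [Finite V] (S : Set V) (h : ¬ F.Reachable u v) :
    weight S ((F.connectedComponentMk u).map (Hom.ofLE (le_sup_left : F ≤ F ⊔ edge u v))) =
      weight S (F.connectedComponentMk u) + weight S (F.connectedComponentMk v) := by
  unfold weight
  rw [← Set.ncard_union_eq _ (Set.toFinite _) (Set.toFinite _)]
  · congr 1
    ext y
    simp only [ConnectedComponent.map_mk, ConnectedComponent.mem_supp_iff, ConnectedComponent.eq,
      reachable_sup_edge_iff, Hom.ofLE_apply, Set.mem_inter_iff, Set.mem_union]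
    have : F.Reachable u u := .rfl
    have : F.Reachable v v := .rfl
    tauto
  · rw [Set.disjoint_left]
    rintro y ⟨h1, -⟩ ⟨h2, -⟩
    exact h ((ConnectedComponent.exact h1).symm.trans (ConnectedComponent.exact h2))

/-- The product over all components of the number of vertices of `S`. -/
noncomputable def weightProd (F : SimpleGraph V) (S : Set V) : ℚ :=
  ∏ᶠ C : F.ConnectedComponent, (weight S C : ℚ)

theorem weight_pos [Finite V] {S : Set V} {x : V} (hx : x ∈ S) :
    0 < weight S (F.connectedComponentMk x) :=
  (Set.ncard_pos (Set.toFinite _)).2 ⟨x, rfl, hx⟩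

/-- Two factors `a`, `b` are replaced by `a + b = a b (1/a + 1/b)`. Only these two must be nonzero,
which `u, v ∈ S` ensures; other weights may vanish. -/
theorem weightProd_sup_edge [Finite V] {S : Set V} (hu : u ∈ S) (hv : v ∈ S)
    (h : ¬ F.Reachable u v) :
    weightProd (F ⊔ edge u v) S = weightProd F S *
      ((weight S (F.connectedComponentMk u) : ℚ)⁻¹ +
        (weight S (F.connectedComponentMk v) : ℚ)⁻¹) := by
  classical
  have := Fintype.ofFinite F.ConnectedComponent
  have := Fintype.ofFinite (F ⊔ edge u v).ConnectedComponent
  have hu0 : (weight S (F.connectedComponentMk u) : ℚ) ≠ 0 := by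
    exact_mod_cast (weight_pos hu).ne'
  have hv0 : (weight S (F.connectedComponentMk v) : ℚ) ≠ 0 := by
    exact_mod_cast (weight_pos hv).ne'
  have hne : F.connectedComponentMk u ≠ F.connectedComponentMk v :=
    fun h' => h (ConnectedComponent.exact h')
  unfold weightProd
  rw [finprod_eq_prod_of_fintype, finprod_eq_prod_of_fintype, ← (mergeEquiv h).prod_comp,
    Fintype.prod_eq_mul_prod_compl (F.connectedComponentMk v)]
  simp only [mergeEquiv_apply]
  rw [← Finset.prod_subtype (p := fun C => C ≠ F.connectedComponentMk v)
      ({F.connectedComponentMk v}ᶜ : Finset F.ConnectedComponent) (by simp)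
      (fun C => (weight S (C.map (Hom.ofLE (le_sup_left : F ≤ F ⊔ edge u v))) : ℚ))]
  have hmem : F.connectedComponentMk u ∈
      ({F.connectedComponentMk v}ᶜ : Finset F.ConnectedComponent) := by simpa using hne
  rw [← Finset.mul_prod_erase _ _ hmem, ← Finset.mul_prod_erase _ _ hmem,
    weight_map_merge S h]
  have : ∀ C ∈ ({F.connectedComponentMk v}ᶜ : Finset F.ConnectedComponent).erase
      (F.connectedComponentMk u),
      (weight S (C.map (Hom.ofLE (le_sup_left : F ≤ F ⊔ edge u v))) : ℚ) = weight S C := by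
    intro C hC
    simp only [Finset.mem_erase, Finset.mem_compl, Finset.mem_singleton] at hC
    rw [weight_map_of_ne S hC.1 hC.2]
  rw [Finset.prod_congr rfl this]
  push_cast
  field_simp
  ring

end Merge

theorem connected_of_card_connectedComponent_le_one {V : Type*} [Finite V] [Nonempty V]
    {F : SimpleGraph V} (h : Nat.card F.ConnectedComponent ≤ 1) : F.Connected := by
  have : Subsingleton F.ConnectedComponent := Finite.card_le_one_iff_subsingleton.1 h
  exact ⟨fun x y => ConnectedComponent.exact (Subsingleton.elim _ _)⟩

theorem isAcyclic_ncard_edgeSet_add_card_connectedComponent {V : Type*} [Finite V]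
    {F : SimpleGraph V} (hF : F.IsAcyclic) :
    F.edgeSet.ncard + Nat.card F.ConnectedComponent = Nat.card V := by
  classical
  rcases isEmpty_or_nonempty V with hV | hV
  · have : IsEmpty F.ConnectedComponent := ⟨fun C => C.ind fun v => hV.elim v⟩
    have : IsEmpty (Sym2 V) := ⟨fun e => e.ind fun v _ => hV.elim v⟩
    simp [Set.eq_empty_of_isEmpty]
  induction hn : Nat.card F.ConnectedComponent generalizing F with
  | zero =>
    have : Nonempty F.ConnectedComponent := ⟨F.connectedComponentMk hV.some⟩
    exact absurd hn Nat.card_pos.ne'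
  | succ n ih =>
    by_cases hc : F.Connected
    · have := (isTree_iff_connected_and_card.1 ⟨hc, hF⟩).2
      have hs := hc.preconnected.subsingleton_connectedComponent
      have := Finite.card_le_one_iff_subsingleton.2 hs
      rw [← Nat.card_coe_set_eq]
      omega
    · have : ¬ F.Preconnected := fun h => hc ⟨h⟩
      obtain ⟨u, v, huv⟩ : ∃ u v, ¬ F.Reachable u v := by
        simpa [Preconnected] using this
      -- The new edge lowers the number of components by one and raises the number of edges by one,
      -- so the sum is unchanged.
      have h1 := card_connectedComponent_sup_edge huv
      have h2 := ih (hF.sup_edge_of_not_reachable huv) (by omega)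
      rw [ncard_edgeSet_sup_edge huv] at h2
      omega

end CliqueForest

namespace CliqueForest

/-! ### Counting tree completions of a forest by double counting -/

section Count

variable {V : Type*}

/-- The trees containing `F` all of whose further edges have both ends in `S`. -/
def treeExtensions (F : SimpleGraph V) (S : Set V) : Set (SimpleGraph V) :=
  {T | T.IsTree ∧ F ≤ T ∧ ∀ u v, T.Adj u v → F.Adj u v ∨ (u ∈ S ∧ v ∈ S)}

theorem ncard_setOf_adj [Finite V] (G : SimpleGraph V) :
    {p : V × V | G.Adj p.1 p.2}.ncard = 2 * G.edgeSet.ncard := by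
  classical
  have := Fintype.ofFinite V
  have h := G.dart_card_eq_twice_card_edges
  have he : G.edgeSet.ncard = G.edgeFinset.card := by
    rw [← coe_edgeFinset, Set.ncard_coe_finset]
  rw [he, ← h, ← Nat.card_eq_fintype_card, ← Set.ncard_univ (α := G.Dart)]
  symm
  refine Set.ncard_congr (fun d _ => d.toProd) (fun d _ => d.adj)
    (fun a b _ _ h => Dart.ext _ _ h) (fun p hp => ⟨⟨p, hp⟩, trivial, rfl⟩)

/-- The edge `uv` is a bridge of `T`, and `F` survives its deletion. -/
theorem IsTree.not_reachable_of_le {F T : SimpleGraph V} (hT : T.IsTree) (hFT : F ≤ T) {u v : V}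
    (hT' : T.Adj u v) (hF : ¬ F.Adj u v) : ¬ F.Reachable u v := by
  have hb := isAcyclic_iff_forall_adj_isBridge.1 hT.isAcyclic hT'
  rw [isBridge_iff] at hb
  intro h
  refine hb (h.mono fun x y hxy => (deleteEdges_adj ..).2 ⟨hFT hxy, fun he => hF ?_⟩)
  rcases Sym2.eq_iff.1 (Set.mem_singleton_iff.1 he) with ⟨rfl, rfl⟩ | ⟨rfl, rfl⟩
  · exact hxy
  · exact hxy.symm

theorem mem_treeExtensions_sup_edge {F T : SimpleGraph V} {S : Set V} {u v : V}
    (hu : u ∈ S) (hv : v ∈ S) (h : ¬ F.Reachable u v) :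
    T ∈ treeExtensions (F ⊔ edge u v) S ↔ T ∈ treeExtensions F S ∧ T.Adj u v := by
  have hne : u ≠ v := by rintro rfl; exact h .rfl
  constructor
  · rintro ⟨h1, h2, h3⟩
    refine ⟨⟨h1, le_sup_left.trans h2, fun x y hxy => ?_⟩,
      h2 (Or.inr ((edge_adj ..).2 ⟨.inl ⟨rfl, rfl⟩, hne⟩))⟩
    rcases h3 x y hxy with (h | h) | h
    · exact .inl h
    · rcases ((edge_adj ..).1 h).1 with ⟨rfl, rfl⟩ | ⟨rfl, rfl⟩
      · exact .inr ⟨hu, hv⟩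
      · exact .inr ⟨hv, hu⟩
    · exact .inr h
  · rintro ⟨⟨h1, h2, h3⟩, h4⟩
    exact ⟨h1, sup_le h2 ((edge_le_iff T).2 (.inr h4)), fun x y hxy => (h3 x y hxy).imp .inl id⟩

-- Double count of pairs `(p, T)` with `p` an ordered pair: the edges of `T \ F` number `|V| - 1 -
-- |E(F)|`, one less than the components of `F`, and each occurs in both orientations.
open Classical in
theorem sum_ncard_treeExtensions_sup_edge [Fintype V] {F : SimpleGraph V} (hF : F.IsAcyclic)
    (S : Set V) :
    ∑ p : V × V with p.1 ∈ S ∧ p.2 ∈ S ∧ ¬ F.Reachable p.1 p.2,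
      (treeExtensions (F ⊔ edge p.1 p.2) S).ncard =
    (treeExtensions F S).ncard * (2 * (Nat.card F.ConnectedComponent - 1)) := by
  have key := Finset.sum_card_bipartiteAbove_eq_sum_card_bipartiteBelow
    (s := {p : V × V | p.1 ∈ S ∧ p.2 ∈ S ∧ ¬ F.Reachable p.1 p.2})
    (t := (treeExtensions F S).toFinset) (fun p T => T.Adj p.1 p.2)
  have hA : ∀ p ∈ ({p : V × V | p.1 ∈ S ∧ p.2 ∈ S ∧ ¬ F.Reachable p.1 p.2} : Finset (V × V)),
      (treeExtensions (F ⊔ edge p.1 p.2) S).ncard =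
      (Finset.bipartiteAbove (fun (p : V × V) (T : SimpleGraph V) => T.Adj p.1 p.2)
        (treeExtensions F S).toFinset p).card := by
    intro p hp
    simp only [Finset.mem_filter, Finset.mem_univ, true_and] at hp
    rw [← Set.ncard_coe_finset]
    congr 1
    ext T
    simp [mem_treeExtensions_sup_edge hp.1 hp.2.1 hp.2.2]
  have hB : ∀ T ∈ (treeExtensions F S).toFinset,
      (Finset.bipartiteBelow (fun (p : V × V) (T : SimpleGraph V) => T.Adj p.1 p.2)
        {p : V × V | p.1 ∈ S ∧ p.2 ∈ S ∧ ¬ F.Reachable p.1 p.2} T).card =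
      2 * (Nat.card F.ConnectedComponent - 1) := by
    intro T hT
    obtain ⟨h1, h2, h3⟩ := Set.mem_toFinset.1 hT
    rw [← Set.ncard_coe_finset]
    have : ((Finset.bipartiteBelow (fun (p : V × V) (T : SimpleGraph V) => T.Adj p.1 p.2)
        {p : V × V | p.1 ∈ S ∧ p.2 ∈ S ∧ ¬ F.Reachable p.1 p.2} T : Finset (V × V)) : Set (V × V))
        = {p | (T \ F).Adj p.1 p.2} := by
      ext ⟨x, y⟩
      simp only [Finset.mem_coe, Finset.mem_bipartiteBelow, Finset.mem_filter, Finset.mem_univ,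
        true_and, Set.mem_ofPred_eq, sdiff_adj]
      constructor
      · rintro ⟨⟨-, -, h⟩, h'⟩
        exact ⟨h', fun hf => h hf.reachable⟩
      · rintro ⟨h, h'⟩
        have := (h3 x y h).resolve_left h'
        exact ⟨⟨this.1, this.2, IsTree.not_reachable_of_le h1 h2 h h'⟩, h⟩
    rw [this, ncard_setOf_adj, edgeSet_sdiff, Set.ncard_sdiff (edgeSet_mono h2) (Set.toFinite _)]
    have hT := (isTree_iff_connected_and_card.1 h1).2
    rw [Nat.card_coe_set_eq] at hT
    have := isAcyclic_ncard_edgeSet_add_card_connectedComponent hF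
    omega
  rw [Finset.sum_congr rfl hA, key, Finset.sum_congr rfl hB, Finset.sum_const, smul_eq_mul,
    Set.ncard_eq_toFinset_card']

theorem treeExtensions_of_isTree [Finite V] {F : SimpleGraph V} (hF : F.IsTree) (S : Set V) :
    treeExtensions F S = {F} := by
  ext T
  simp only [Set.mem_singleton_iff]
  constructor
  · rintro ⟨h1, h2, -⟩
    by_contra hne
    obtain ⟨x, y, h, h'⟩ : ∃ x y, T.Adj x y ∧ ¬ F.Adj x y := by
      by_contra! hc
      exact hne (le_antisymm (fun x y => hc x y) h2)
    exact IsTree.not_reachable_of_le h1 h2 h h' (hF.connected.preconnected x y)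
  · rintro rfl
    exact ⟨hF, le_rfl, fun _ _ => .inl⟩

-- Each component `C` contributes `weight S C` equal terms `1 / weight S C`, hence exactly `1`.
open Classical in
theorem sum_inv_weight [Fintype V] {F : SimpleGraph V} (S : Set V)
    (h : ∀ C : F.ConnectedComponent, weight S C ≠ 0) :
    ∑ u with u ∈ S, (weight S (F.connectedComponentMk u) : ℚ)⁻¹ =
      Nat.card F.ConnectedComponent := by
  have := Fintype.ofFinite F.ConnectedComponent
  rw [← Finset.sum_fiberwise (s := {u | u ∈ S}) (g := F.connectedComponentMk),
    Nat.card_eq_fintype_card, Fintype.card_eq_sum_ones]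
  push_cast
  refine Finset.sum_congr rfl fun C _ => ?_
  rw [Finset.sum_congr rfl (g := fun _ => (weight S C : ℚ)⁻¹) (by
    intro u hu
    rw [(Finset.mem_filter.1 hu).2]), Finset.sum_const, nsmul_eq_mul]
  have : (Finset.filter (fun u => F.connectedComponentMk u = C) {u | u ∈ S}).card
      = weight S C := by
    rw [weight, ← Set.ncard_coe_finset]
    congr 1
    ext u
    simp [and_comm]
  rw [this, mul_inv_cancel₀ (by exact_mod_cast h C)]

-- For fixed `u` there are `|S| - w(u)` choices of `v`, contributing `|S| / w(u) - 1`;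
-- `sum_inv_weight` then sums this over `u`.
open Classical in
theorem sum_not_reachable_inv_weight [Fintype V] {F : SimpleGraph V} (S : Set V)
    (h : ∀ C : F.ConnectedComponent, weight S C ≠ 0) :
    ∑ p : V × V with p.1 ∈ S ∧ p.2 ∈ S ∧ ¬ F.Reachable p.1 p.2,
      (weight S (F.connectedComponentMk p.1) : ℚ)⁻¹ =
    S.ncard * (Nat.card F.ConnectedComponent - 1) := by
  have hk : ∀ u, ((Finset.filter (fun v => v ∈ S ∧ ¬ F.Reachable u v) Finset.univ).card : ℚ) =
      S.ncard - weight S (F.connectedComponentMk u) := by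
    intro u
    rw [eq_sub_iff_add_eq, weight, ← Set.ncard_coe_finset]
    rw [← Nat.cast_add, Nat.cast_inj, ← Set.ncard_union_eq _ (Set.toFinite _) (Set.toFinite _)]
    · congr 1
      ext v
      simp only [Finset.coe_filter, Finset.mem_univ, true_and, Set.mem_union, Set.mem_ofPred_eq,
        Set.mem_inter_iff, ConnectedComponent.mem_supp_iff, ConnectedComponent.eq,
        reachable_comm (u := v)]
      tauto
    · rw [Set.disjoint_left]
      rintro v hv ⟨hv', -⟩
      simp only [Finset.coe_filter, Finset.mem_univ, true_and, Set.mem_ofPred_eq] at hv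
      exact hv.2 (ConnectedComponent.exact hv').symm
  have h1 : ∑ p : V × V with p.1 ∈ S ∧ p.2 ∈ S ∧ ¬ F.Reachable p.1 p.2,
      (weight S (F.connectedComponentMk p.1) : ℚ)⁻¹ =
      ∑ u with u ∈ S, ∑ v with v ∈ S ∧ ¬ F.Reachable u v,
        (weight S (F.connectedComponentMk u) : ℚ)⁻¹ := by
    rw [Finset.sum_filter, ← Finset.univ_product_univ, Finset.sum_product, Finset.sum_filter]
    refine Finset.sum_congr rfl fun u _ => ?_
    by_cases hu : u ∈ S
    · simp only [hu, true_and, if_true, Finset.sum_filter]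
    · simp [hu]
  have h2 : ∀ u, ∑ v with v ∈ S ∧ ¬ F.Reachable u v,
        (weight S (F.connectedComponentMk u) : ℚ)⁻¹ =
        S.ncard * (weight S (F.connectedComponentMk u) : ℚ)⁻¹ - 1 := by
    intro u
    rw [Finset.sum_const, nsmul_eq_mul, hk, sub_mul,
      mul_inv_cancel₀ (by exact_mod_cast h _)]
  rw [h1, Finset.sum_congr rfl fun u _ => h2 u, Finset.sum_sub_distrib, ← Finset.mul_sum,
    sum_inv_weight S h, Finset.sum_const, nsmul_eq_mul, ← Set.ncard_coe_finset]
  have : ((({u | u ∈ S} : Finset V)) : Set V) = S := by ext; simp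
  rw [this]
  ring

open Classical in
theorem sum_weightProd_sup_edge [Fintype V] (F : SimpleGraph V) (S : Set V) :
    ∑ p : V × V with p.1 ∈ S ∧ p.2 ∈ S ∧ ¬ F.Reachable p.1 p.2,
      weightProd (F ⊔ edge p.1 p.2) S =
    2 * (Nat.card F.ConnectedComponent - 1) * S.ncard * weightProd F S := by
  have hs : ∀ p ∈ ({p : V × V | p.1 ∈ S ∧ p.2 ∈ S ∧ ¬ F.Reachable p.1 p.2} : Finset (V × V)),
      weightProd (F ⊔ edge p.1 p.2) S = weightProd F S *
      ((weight S (F.connectedComponentMk p.1) : ℚ)⁻¹ +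
        (weight S (F.connectedComponentMk p.2) : ℚ)⁻¹) := by
    intro p hp
    simp only [Finset.mem_filter, Finset.mem_univ, true_and] at hp
    exact weightProd_sup_edge hp.1 hp.2.1 hp.2.2
  rw [Finset.sum_congr rfl hs, ← Finset.mul_sum]
  -- The reciprocal sums need nonzero weights; if some weight is zero, both sides carry the factor
  -- `weightProd F S = 0`.
  by_cases h : ∀ C : F.ConnectedComponent, weight S C ≠ 0
  · have hswap : ∑ p : V × V with p.1 ∈ S ∧ p.2 ∈ S ∧ ¬ F.Reachable p.1 p.2,
        (weight S (F.connectedComponentMk p.2) : ℚ)⁻¹ =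
        ∑ p : V × V with p.1 ∈ S ∧ p.2 ∈ S ∧ ¬ F.Reachable p.1 p.2,
        (weight S (F.connectedComponentMk p.1) : ℚ)⁻¹ := by
      refine Finset.sum_equiv (Equiv.prodComm V V) (fun p => ?_) fun p _ => rfl
      simp only [Finset.mem_filter, Finset.mem_univ, true_and, Equiv.prodComm_apply, Prod.fst_swap,
        Prod.snd_swap, reachable_comm (u := p.2)]
      tauto
    rw [Finset.sum_add_distrib, hswap, sum_not_reachable_inv_weight S h]
    ring
  · push Not at h
    obtain ⟨C, hC⟩ := h
    have : weightProd F S = 0 := by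
      have := Fintype.ofFinite F.ConnectedComponent
      rw [weightProd, finprod_eq_prod_of_fintype]
      exact Finset.prod_eq_zero (Finset.mem_univ C) (by simp [hC])
    simp [this]

/-- The number of trees obtained from a forest `F` by adding edges with both ends in `S`. -/
theorem ncard_treeExtensions [Finite V] {F : SimpleGraph V} (hF : F.IsAcyclic) {S : Set V}
    (hS : S.Nonempty) :
    ((treeExtensions F S).ncard : ℚ) =
      (S.ncard : ℚ) ^ ((Nat.card F.ConnectedComponent : ℤ) - 2) * weightProd F S := by
  classical
  have := Fintype.ofFinite V
  have : Nonempty V := ⟨hS.some⟩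
  have hk : (S.ncard : ℚ) ≠ 0 := by
    exact_mod_cast ((Set.ncard_pos (Set.toFinite _)).2 hS).ne'
  induction hn : Nat.card F.ConnectedComponent generalizing F with
  | zero =>
    have : Nonempty F.ConnectedComponent := ⟨F.connectedComponentMk hS.some⟩
    exact absurd hn Nat.card_pos.ne'
  | succ n ih =>
    rcases Nat.eq_zero_or_pos n with rfl | hpos
    -- With one component the exponent is `-1` and the only weight is `|S|`, so the formula gives
    -- `1`. This case is separate because the induction step divides by `2 (c - 1)`.
    · have hc := connected_of_card_connectedComponent_le_one hn.le
      rw [treeExtensions_of_isTree ⟨hc, hF⟩]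
      have hw : weightProd F S = S.ncard := by
        have hs := hc.preconnected.subsingleton_connectedComponent
        have : Unique F.ConnectedComponent :=
          ⟨⟨F.connectedComponentMk hS.some⟩, fun _ => Subsingleton.elim _ _⟩
        rw [weightProd, finprod_unique, weight]
        congr 2
        ext v
        simp only [Set.mem_inter_iff, ConnectedComponent.mem_supp_iff, and_iff_right_iff_imp]
        exact fun _ => Subsingleton.elim _ _
      rw [hw]
      norm_num
      field_simp
    · have hsum := sum_ncard_treeExtensions_sup_edge hF S
      have hsum' : ((∑ p : V × V with p.1 ∈ S ∧ p.2 ∈ S ∧ ¬ F.Reachable p.1 p.2,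
          (treeExtensions (F ⊔ edge p.1 p.2) S).ncard : ℕ) : ℚ) =
          (S.ncard : ℚ) ^ ((n : ℤ) - 2) *
            ∑ p : V × V with p.1 ∈ S ∧ p.2 ∈ S ∧ ¬ F.Reachable p.1 p.2,
              weightProd (F ⊔ edge p.1 p.2) S := by
        rw [Nat.cast_sum, Finset.mul_sum]
        refine Finset.sum_congr rfl fun p hp => ?_
        simp only [Finset.mem_filter, Finset.mem_univ, true_and] at hp
        have := card_connectedComponent_sup_edge hp.2.2
        exact ih (hF.sup_edge_of_not_reachable hp.2.2) (by omega)
      rw [hsum, sum_weightProd_sup_edge, hn] at hsum'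
      have hn0 : (n : ℚ) ≠ 0 := by exact_mod_cast hpos.ne'
      have he : (S.ncard : ℚ) ^ (((n + 1 : ℕ) : ℤ) - 2) =
          (S.ncard : ℚ) ^ ((n : ℤ) - 2) * S.ncard := by
        rw [← zpow_add_one₀ hk]
        congr 1
        push_cast
        ring
      rw [he]
      push_cast [Nat.add_sub_cancel] at hsum'
      refine mul_right_cancel₀ (mul_ne_zero two_ne_zero hn0) ?_
      rw [hsum']
      ring

end Count

end CliqueForest

namespace CliqueForest

/-! ### Components of `G - E(G[V₀])` and their weights -/

section Clique

variable {V : Type*} {G : SimpleGraph V} {V₀ : Set V}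

theorem minusInducedEdges_adj {a b : V} :
    (minusInducedEdges G V₀).Adj a b ↔ G.Adj a b ∧ ¬ (a ∈ V₀ ∧ b ∈ V₀) := by
  simp only [minusInducedEdges, deleteEdges_adj, mem_edgeSet, map_adj, comap_adj,
    Function.Embedding.subtype_apply]
  constructor
  · rintro ⟨h, h'⟩
    exact ⟨h, fun ⟨ha, hb⟩ => h' ⟨⟨a, ha⟩, ⟨b, hb⟩, h, rfl, rfl⟩⟩
  · rintro ⟨h, h'⟩
    refine ⟨h, ?_⟩
    rintro ⟨⟨x, hx⟩, ⟨y, hy⟩, -, rfl, rfl⟩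
    exact h' ⟨hx, hy⟩

theorem spanningTreesContaining_eq_treeExtensions (hclique : G.IsClique V₀) :
    spanningTreesContaining G (minusInducedEdges G V₀) =
      treeExtensions (minusInducedEdges G V₀) V₀ := by
  ext T
  simp only [spanningTreesContaining, treeExtensions, Set.mem_ofPred_eq, edgeSet_subset_edgeSet]
  constructor
  · rintro ⟨h1, h2, h3⟩
    refine ⟨h2, h3, fun u v h => ?_⟩
    rw [minusInducedEdges_adj]
    have := h1 h
    tauto
  · rintro ⟨h1, h2, h3⟩
    refine ⟨fun u v h => ?_, h1, h2⟩
    rcases h3 u v h with h' | ⟨hu, hv⟩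
    · exact (minusInducedEdges_adj.1 h').1
    · exact hclique hu hv h.ne

/-- The vertices of `V₀` that have no neighbour outside `V₀`. -/
abbrev InnerVertex (G : SimpleGraph V) (V₀ : Set V) : Type _ :=
  {v : V // v ∈ V₀ ∧ ∀ w, ¬ (minusInducedEdges G V₀).Adj v w}

theorem notMem_of_adj {v w : V} (hv : v ∈ V₀) (h : (minusInducedEdges G V₀).Adj v w) :
    w ∈ V₀ᶜ := fun hw => (minusInducedEdges_adj.1 h).2 ⟨hv, hw⟩

open Classical in
/-- Sends a vertex to the outer component it lies in or is attached to, and an inner vertex to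
itself. -/
noncomputable def retraction (G : SimpleGraph V) (V₀ : Set V) (v : V) :
    OuterComponent G V₀ ⊕ InnerVertex G V₀ :=
  if h : v ∈ V₀ then
    if h' : ∃ w, (minusInducedEdges G V₀).Adj v w then
      .inl ((G.induce V₀ᶜ).connectedComponentMk ⟨h'.choose, notMem_of_adj h h'.choose_spec⟩)
    else .inr ⟨v, h, not_exists.1 h'⟩
  else .inl ((G.induce V₀ᶜ).connectedComponentMk ⟨v, h⟩)

theorem retraction_of_notMem {v : V} (h : v ∈ V₀ᶜ) :
    retraction G V₀ v = .inl ((G.induce V₀ᶜ).connectedComponentMk ⟨v, h⟩) :=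
  dif_neg h

theorem retraction_inner (v : InnerVertex G V₀) : retraction G V₀ v = .inr v := by
  have h' : ¬ ∃ w, (minusInducedEdges G V₀).Adj v w := not_exists.2 v.2.2
  simp only [retraction, v.2.1, h', dite_true, dite_false]

variable (hu : ∀ v ∈ V₀, ∀ w w', (minusInducedEdges G V₀).Adj v w →
  (minusInducedEdges G V₀).Adj v w' → w = w')

include hu

theorem retraction_of_adj {v w : V} (hv : v ∈ V₀) (h : (minusInducedEdges G V₀).Adj v w) :
    retraction G V₀ v = .inl ((G.induce V₀ᶜ).connectedComponentMk ⟨w, notMem_of_adj hv h⟩) := by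
  have h' : ∃ w, (minusInducedEdges G V₀).Adj v w := ⟨w, h⟩
  simp only [retraction, hv, h', dite_true]
  congr 3
  exact hu v hv _ _ h'.choose_spec h

theorem retraction_eq_of_adj {v w : V} (h : (minusInducedEdges G V₀).Adj v w) :
    retraction G V₀ v = retraction G V₀ w := by
  by_cases hv : v ∈ V₀
  · rw [retraction_of_adj hu hv h, retraction_of_notMem (notMem_of_adj hv h)]
  · by_cases hw : w ∈ V₀
    · rw [retraction_of_adj hu hw h.symm, retraction_of_notMem hv]
    · rw [retraction_of_notMem hv, retraction_of_notMem hw]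
      congr 1
      exact ConnectedComponent.sound (Adj.reachable (minusInducedEdges_adj.1 h).1)

/-- The components of `G - E(G[V₀])` are the outer components with the vertices of `V₀` attached
to them, and the inner vertices. -/
noncomputable def componentEquiv :
    (minusInducedEdges G V₀).ConnectedComponent ≃ OuterComponent G V₀ ⊕ InnerVertex G V₀ where
  -- `retraction` is constant along edges, hence along walks.
  toFun := ConnectedComponent.lift (retraction G V₀) fun v w p _ => by
    induction p with
    | nil => rfl
    | cons h p ih => exact (retraction_eq_of_adj hu h).trans (ih (by simp_all [Walk.cons_isPath_iff]))
  invFun := Sum.elim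
    (fun C => C.map (⟨fun a : (V₀ᶜ : Set V) => a.1,
      fun {a b} h => minusInducedEdges_adj.2 ⟨h, fun h' => a.2 h'.1⟩⟩ :
        G.induce V₀ᶜ →g minusInducedEdges G V₀))
    (fun v => (minusInducedEdges G V₀).connectedComponentMk v)
  left_inv C := by
    induction C using ConnectedComponent.ind with | _ v
    rw [ConnectedComponent.lift_mk]
    by_cases hv : v ∈ V₀
    · by_cases h : ∃ w, (minusInducedEdges G V₀).Adj v w
      · obtain ⟨w, h⟩ := h
        rw [retraction_of_adj hu hv h]
        exact ConnectedComponent.sound h.symm.reachable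
      · rw [retraction_inner ⟨v, hv, not_exists.1 h⟩]
        rfl
    · rw [retraction_of_notMem hv]
      rfl
  right_inv x := by
    rcases x with C | v
    · induction C using ConnectedComponent.ind with | _ v
      exact retraction_of_notMem v.2
    · exact retraction_inner v

theorem weight_componentEquiv_symm (x : OuterComponent G V₀ ⊕ InnerVertex G V₀) :
    weight V₀ ((componentEquiv hu).symm x) = {v | v ∈ V₀ ∧ retraction G V₀ v = x}.ncard := by
  unfold weight
  congr 1
  ext v
  simp only [Set.mem_inter_iff, ConnectedComponent.mem_supp_iff, Set.mem_ofPred_eq,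
    Equiv.eq_symm_apply, and_comm (a := v ∈ V₀)]
  rfl

theorem weight_componentEquiv_symm_inr (v : InnerVertex G V₀) :
    weight V₀ ((componentEquiv hu).symm (.inr v)) = 1 := by
  rw [weight_componentEquiv_symm, Set.ncard_eq_one]
  refine ⟨v, ?_⟩
  ext w
  simp only [Set.mem_ofPred_eq, Set.mem_singleton_iff]
  constructor
  · rintro ⟨hw, h⟩
    by_cases h' : ∃ x, (minusInducedEdges G V₀).Adj w x
    · obtain ⟨x, hx⟩ := h'
      rw [retraction_of_adj hu hw hx] at h
      cases h
    · rw [retraction_inner ⟨w, hw, not_exists.1 h'⟩] at h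
      exact congrArg Subtype.val (Sum.inr.inj h)
  · rintro rfl
    exact ⟨v.2.1, retraction_inner v⟩

/-- By `hu`, an edge leaving `V₀` is determined by its end in `V₀`, so edges can be counted by these
ends. -/
theorem ncard_edgesBetween {B : Set V} (hB : B ⊆ V₀ᶜ) :
    (edgesBetween G V₀ B).ncard =
      {v | v ∈ V₀ ∧ ∃ w ∈ B, (minusInducedEdges G V₀).Adj v w}.ncard := by
  symm
  refine Set.ncard_congr (fun v hv => s(v, hv.2.choose)) ?_ ?_ ?_
  · rintro v ⟨hv, h⟩
    exact ⟨(minusInducedEdges_adj.1 h.choose_spec.2).1, v, hv, _, h.choose_spec.1, rfl⟩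
  · rintro v v' ⟨hv, h⟩ ⟨hv', h'⟩ he
    rcases Sym2.eq_iff.1 he with he | he
    · exact he.1
    · exact absurd (he.1 ▸ hv) (hB h'.choose_spec.1)
  · rintro _ ⟨he, a, ha, b, hb, rfl⟩
    have hab : (minusInducedEdges G V₀).Adj a b :=
      minusInducedEdges_adj.2 ⟨he, fun h => hB hb h.2⟩
    have h : ∃ w ∈ B, (minusInducedEdges G V₀).Adj a w := ⟨b, hb, hab⟩
    exact ⟨a, ⟨ha, h⟩, by rw [hu a ha _ _ h.choose_spec.2 hab]⟩

theorem weight_componentEquiv_symm_inl (C : OuterComponent G V₀) :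
    weight V₀ ((componentEquiv hu).symm (.inl C)) =
      (edgesBetween G V₀ (outerVerts G V₀ C)).ncard := by
  rw [weight_componentEquiv_symm, ncard_edgesBetween hu]
  · congr 1
    ext v
    simp only [Set.mem_ofPred_eq, outerVerts, Set.mem_image, Subtype.exists,
      ConnectedComponent.mem_supp_iff]
    refine and_congr_right fun hv => ?_
    constructor
    · intro h
      by_cases h' : ∃ x, (minusInducedEdges G V₀).Adj v x
      · obtain ⟨x, hx⟩ := h'
        rw [retraction_of_adj hu hv hx] at h
        exact ⟨x, ⟨x, notMem_of_adj hv hx, Sum.inl.inj h, rfl⟩, hx⟩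
      · rw [retraction_inner ⟨v, hv, not_exists.1 h'⟩] at h
        cases h
    · rintro ⟨_, ⟨w, hw, hC, rfl⟩, h⟩
      rw [retraction_of_adj hu hv h, hC]
  · rintro _ ⟨w, -, rfl⟩
    exact w.2

theorem weightProd_minusInducedEdges [Finite V] :
    weightProd (minusInducedEdges G V₀) V₀ =
      ∏ᶠ C : OuterComponent G V₀, ((edgesBetween G V₀ (outerVerts G V₀ C)).ncard : ℚ) := by
  classical
  have := Fintype.ofFinite (minusInducedEdges G V₀).ConnectedComponent
  have := Fintype.ofFinite (OuterComponent G V₀)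
  have := Fintype.ofFinite (InnerVertex G V₀)
  rw [weightProd, finprod_eq_prod_of_fintype, finprod_eq_prod_of_fintype,
    ← (componentEquiv hu).symm.prod_comp, Fintype.prod_sum_type]
  simp [weight_componentEquiv_symm_inr, weight_componentEquiv_symm_inl]

theorem card_connectedComponent_minusInducedEdges [Finite V] :
    Nat.card (minusInducedEdges G V₀).ConnectedComponent + (edgeCut G V₀).ncard =
      V₀.ncard + Nat.card (OuterComponent G V₀) := by
  -- Each vertex of `V₀` is either inner or the end of exactly one cut edge.
  have hI : Nat.card (InnerVertex G V₀) + (edgeCut G V₀).ncard = V₀.ncard := by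
    rw [edgeCut, ncard_edgesBetween hu subset_rfl]
    change Nat.card {v : V | v ∈ V₀ ∧ ∀ w, ¬ (minusInducedEdges G V₀).Adj v w} + _ = _
    rw [Nat.card_coe_set_eq, ← Set.ncard_union_eq _ (Set.toFinite _) (Set.toFinite _)]
    · congr 1
      ext v
      simp only [Set.mem_union, Set.mem_ofPred_eq]
      constructor
      · rintro (h | h) <;> exact h.1
      · intro hv
        by_cases h' : ∃ x, (minusInducedEdges G V₀).Adj v x
        · obtain ⟨x, hx⟩ := h'
          exact .inr ⟨hv, x, notMem_of_adj hv hx, hx⟩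
        · exact .inl ⟨hv, not_exists.1 h'⟩
    · rw [Set.disjoint_left]
      rintro v ⟨-, h⟩ ⟨-, w, -, hw⟩
      exact h w hw
  rw [Nat.card_congr (componentEquiv hu), Nat.card_sum]
  omega

end Clique

theorem eq_of_ncard_incidenceSet_le_one {V : Type*} [Finite V] {F : SimpleGraph V} {v w w' : V}
    (h : (F.incidenceSet v).ncard ≤ 1) (hw : F.Adj v w) (hw' : F.Adj v w') : w = w' := by
  have := (Set.ncard_le_one (Set.toFinite _)).1 h s(v, w) ⟨hw, Sym2.mem_mk_left ..⟩
    s(v, w') ⟨hw', Sym2.mem_mk_left ..⟩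
  exact Sym2.congr_right.1 this

end CliqueForest

theorem mainTheorem5 {V : Type*} [Finite V] (G : SimpleGraph V) (V₀ : Set V)
    (hne : V₀.Nonempty) (hclique : G.IsClique V₀)
    (hforest : (CliqueForest.minusInducedEdges G V₀).IsAcyclic)
    (hdeg : ∀ v ∈ V₀, ((CliqueForest.minusInducedEdges G V₀).incidenceSet v).ncard ≤ 1) :
    ((CliqueForest.spanningTreesContaining G
        (CliqueForest.minusInducedEdges G V₀)).ncard : ℚ) =
      (V₀.ncard : ℚ) ^ ((V₀.ncard : ℤ) - 2 + (Nat.card (CliqueForest.OuterComponent G V₀) : ℤ)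
          - ((CliqueForest.edgeCut G V₀).ncard : ℤ)) *
        ∏ᶠ C : CliqueForest.OuterComponent G V₀,
          ((CliqueForest.edgesBetween G V₀ (CliqueForest.outerVerts G V₀ C)).ncard : ℚ) :=
 by
  have hu : ∀ v ∈ V₀, ∀ w w', (CliqueForest.minusInducedEdges G V₀).Adj v w →
      (CliqueForest.minusInducedEdges G V₀).Adj v w' → w = w' := fun v hv _ _ hw hw' =>
    CliqueForest.eq_of_ncard_incidenceSet_le_one (hdeg v hv) hw hw'
  rw [CliqueForest.spanningTreesContaining_eq_treeExtensions hclique,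
    CliqueForest.ncard_treeExtensions hforest hne, CliqueForest.weightProd_minusInducedEdges hu]
  have := CliqueForest.card_connectedComponent_minusInducedEdges hu
  congr 2
  omega
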